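/- Let $q$ be a prime power, let $\ell>n\geq 2$ be integers, and let $\mathbb{F}_q^{n+\ell}$ have standard basis $e_1,\dots,e_{n+\ell}$; put $E=\langle e_{n+1},\dots,e_{n+\ell}\rangle$. A subspace $P$ of $\mathbb{F}_q^{n+\ell}$ is said to be of type $(m,k)$ if $\dim P=m$ and $\dim(P\cap E)=k$. Let ${\cal M}_m$ denote the set of all subspaces of type $(m,0)$, and for a subspace $V$ let ${\cal M}_n(V)=\{\pi\in{\cal M}_n:\pi\subseteq V\}$. Let $M$ be the $0$-$1$ incidence matrix (over $\mathbb{R}$) with rows indexed by ${\cal M}_1$ and columns indexed by ${\cal M}_n$, whose $(\tau,\pi)$ entry is $1$ if and only if $\tau\subseteq\pi$. A set ${\cal L}\subseteq{\cal M}_n$ is a Cameron-Liebler set in the bilinear forms graph ${\rm Bil}_q(n,\ell)$ with parameter $x=q^{-(n-1)\ell}|{\cal L}|$ if its characteristic vector lies in ${\rm Im}(M^t)$. It is trivial if it is a union of $x$ intersecting families, where ${\cal F}\subseteq{\cal M}_n$ is intersecting if $\dim(\pi\cap\pi')\geq 1$ for all $\pi,\pi'\in{\cal F}$; otherwise it is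 non-trivial. Then the following hold. (i) For every subspace $V$ of type $(n+\ell-1,\ell-1)$, the set ${\cal M}_n(V)$ is a non-trivial Cameron-Liebler set in ${\rm Bil}_q(n,\ell)$ with parameter $q^{\ell-n}$. (ii) Let $y$ be an integer with $1\leq y<q^{n-1}$, and let $V_1,\dots,V_y$ be subspaces of type $(n+\ell-1,\ell-1)$ with ${\cal M}_n(V_i)\cap{\cal M}_n(V_j)=\emptyset$ for all $i\neq j$. Then $\bigcup_{i=1}^y{\cal M}_n(V_i)$ is a non-trivial Cameron-Liebler set in ${\rm Bil}_q(n,\ell)$ with parameter $yq^{\ell-n}$. -/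

import Mathlib

open scoped Matrix

noncomputable section

namespace BilinearForms

variable (F : Type*) [Field F] (n l : ℕ)

/-- The `l`-dimensional subspace `E` of `F^(n+l)` spanned by the last `l` standard
basis vectors `e_{n+1}, …, e_{n+l}`. -/
def E : Submodule F (Fin (n + l) → F) :=
  Submodule.span F (Set.range fun i : Fin l => Pi.single (Fin.natAdd n i) (1 : F))

/-- The set of all subspaces of type `(m, k)`: the `m`-dimensional subspaces `P` of `F^(n+l)`
with `dim (P ∩ E) = k`. -/
def subspacesOfType (m k : ℕ) : Set (Submodule F (Fin (n + l) → F)) :=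
  {P | Module.finrank F P = m ∧ Module.finrank F ↥(P ⊓ E F n l) = k}

/-- The set `𝓜_m` of all `m`-dimensional subspaces meeting `E` trivially.
The vertices of `Bil_q(n, l)` are the elements of `𝓜_n`. -/
def attenuated (m : ℕ) : Set (Submodule F (Fin (n + l) → F)) :=
  subspacesOfType F n l m 0

variable {F n l}

/-- The set `𝓜_m(S)` of all elements of `𝓜_m` that are contained in `S`. -/
def attenuatedIn (m : ℕ) (S : Submodule F (Fin (n + l) → F)) :
    Set (Submodule F (Fin (n + l) → F)) :=
  {P | P ∈ attenuated F n l m ∧ P ≤ S}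

variable (F n l) in
open Classical in
/-- The incidence matrix of one-dimensional subspaces versus `n`-dimensional subspaces of the
attenuated space. -/
def incidenceMatrix : Matrix (attenuated F n l 1) (attenuated F n l n) ℝ :=
  Matrix.of fun τ π => if (τ : Submodule F (Fin (n + l) → F)) ≤ π then 1 else 0

open Classical in
/-- The characteristic vector of a set of `n`-dimensional subspaces, indexed by `𝓜_n`. -/
def charVec (L : Set (Submodule F (Fin (n + l) → F))) : attenuated F n l n → ℝ :=
  fun π => if (π : Submodule F (Fin (n + l) → F)) ∈ L then 1 else 0

instance instFintypeAttenuated [Fintype F] (m : ℕ) : Fintype (attenuated F n l m) :=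
  Fintype.ofFinite _

/-- `L` is a Cameron-Liebler set in `Bil_q(n, l)` with parameter `x = q^(-(n-1)l) |L|`, where
`q` is the number of elements of `F`: the characteristic vector of `L` lies in the image of the
transpose of the incidence matrix. -/
def IsCameronLiebler [Fintype F] (L : Set (Submodule F (Fin (n + l) → F))) (x : ℝ) : Prop :=
  L ⊆ attenuated F n l n ∧
  charVec L ∈ LinearMap.range (incidenceMatrix F n l)ᵀ.mulVecLin ∧
  x = (Fintype.card F : ℝ) ^ (-(((n : ℤ) - 1) * (l : ℤ))) * (L.ncard : ℝ)

/-- A family of subspaces in `𝓜_n` any two members of which meet in dimension at least `1`. -/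
def IsIntersecting (A : Set (Submodule F (Fin (n + l) → F))) : Prop :=
  A ⊆ attenuated F n l n ∧
  ∀ π ∈ A, ∀ π' ∈ A, 1 ≤ Module.finrank F ↥(π ⊓ π')

/-- `L` is a union of `x` intersecting families. -/
def IsUnionOfIntersecting (L : Set (Submodule F (Fin (n + l) → F))) (x : ℝ) : Prop :=
  ∃ k : ℕ, (k : ℝ) = x ∧ ∃ A : Fin k → Set (Submodule F (Fin (n + l) → F)),
    (∀ i, IsIntersecting (A i)) ∧ L = ⋃ i, A i

/-- A non-trivial Cameron-Liebler set with parameter `x`: a Cameron-Liebler set with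
parameter `x` that is not a union of `x` intersecting families. -/
def IsNontrivialCameronLiebler [Fintype F] (L : Set (Submodule F (Fin (n + l) → F)))
    (x : ℝ) : Prop :=
  IsCameronLiebler L x ∧ ¬ IsUnionOfIntersecting L x

end BilinearForms

end

/-! Write `q` for the order of `F`. A point weighting with one value on the hyperplane `V` and
another off it gives each `π` in `𝓜_n` a sum depending only on `dim (π ∩ V)`, which is `n` or `n -
1`; suitable values yield the characteristic vector of `𝓜_n(V)` (`charVec_mem_range`), and disjoint
unions follow by linearity. Non-triviality is a count. Elements of `𝓜_n(V)` are the complements of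
`V ∩ E` in `V`, so there are `q^(n(l-1))` of them, and an intersecting family contains at most
`q^((n-1)(l-1))` (`ncard_le_of_pairwise_not_disjoint`). Hence `y q^(l-n)` intersecting families
inside the union cover at most `y q^(l-n) * y q^((n-1)(l-1))` elements, fewer than `y q^(n(l-1))`
when `y < q^(n-1)`. -/

noncomputable section

/-! ### Complements of a subspace and an Erdős–Ko–Rado bound. -/

section Complements

open Module

variable {F W : Type*} [Field F] [AddCommGroup W] [Module F W]

/-- Over a finite field, the space of linear maps `Q → U` with `0 < dim Q ≤ dim U` contains a
subspace of dimension `dim U` all of whose nonzero elements are injective. -/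
theorem exists_submodule_linearMap_injective [Finite F] (Q U : Type*)
    [AddCommGroup Q] [Module F Q] [FiniteDimensional F Q]
    [AddCommGroup U] [Module F U] [FiniteDimensional F U]
    (hQ : 0 < finrank F Q) (hQU : finrank F Q ≤ finrank F U) :
    ∃ C : Submodule F (Q →ₗ[F] U), finrank F C = finrank F U ∧
      ∀ φ ∈ C, φ ≠ 0 → Function.Injective φ := by
  obtain ⟨p, hp⟩ := CharP.exists F
  have : Fact p.Prime := ⟨CharP.char_is_prime F p⟩
  have : NeZero (finrank F U) := ⟨(hQ.trans_le hQU).ne'⟩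
  -- Identify `U` with an extension field and embed `Q` in it: multiplication by a nonzero scalar is
  -- injective.
  let K := FiniteField.Extension F p (finrank F U)
  have hK : finrank F K = finrank F U := FiniteField.finrank_extension F p (finrank F U)
  let e : K ≃ₗ[F] U := LinearEquiv.ofFinrankEq K U hK
  obtain ⟨j, hj⟩ : ∃ j : Q →ₗ[F] K, Function.Injective j :=
    finrank_le_iff_exists_linearMap.mp (by rwa [hK])
  let m : K →ₗ[F] Q →ₗ[F] U :=
    (LinearMap.llcomp F Q K U e.toLinearMap) ∘ₗ (LinearMap.lcomp F K j) ∘ₗ LinearMap.mul F K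
  have hm : ∀ c x, m c x = e (c * j x) := fun c x ↦ rfl
  have hinj : ∀ c, c ≠ 0 → Function.Injective (m c) := by
    intro c hc x y hxy
    rw [hm, hm] at hxy
    exact hj (mul_left_cancel₀ hc (e.injective hxy))
  have hm_inj : Function.Injective m := by
    rw [injective_iff_map_eq_zero]
    intro c hc
    by_contra h
    have : Nontrivial Q := Module.finrank_pos_iff.mp hQ
    obtain ⟨x, hx⟩ := exists_ne (0 : Q)
    exact hx (hinj c h (by simp [hc]))
  refine ⟨LinearMap.range m, by rw [LinearMap.finrank_range_of_inj hm_inj, hK], ?_⟩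
  rintro _ ⟨c, rfl⟩ hc
  exact hinj c (by rintro rfl; simp at hc)

/-- The complements of `U` are parametrized by the linear maps from a fixed complement to `U`. -/
def isComplEquivLinearMap {U Q : Submodule F W} (h : IsCompl U Q) :
    {π : Submodule F W // IsCompl U π} ≃ (Q →ₗ[F] U) :=
  U.isComplEquivProj.trans
    { toFun f := f.1.domRestrict Q
      invFun φ := ⟨LinearMap.ofIsCompl h LinearMap.id φ, by simp⟩
      left_inv f := by
        ext1
        exact LinearMap.ofIsCompl_eq h (fun u ↦ (f.2 u).symm) (fun u ↦ rfl)
      right_inv φ := by ext; simp }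

theorem isComplEquivLinearMap_apply {U Q : Submodule F W} (h : IsCompl U Q)
    (π : {π : Submodule F W // IsCompl U π}) (x : Q) :
    isComplEquivLinearMap h π x = U.projectionOnto π.1 π.2 x := rfl

/-- A common vector `u + x` has zero projection to `U` along both complements, so the difference of
the two maps kills `x`. -/
theorem disjoint_of_injective_sub {U Q : Submodule F W} (h : IsCompl U Q)
    (π π' : {π : Submodule F W // IsCompl U π})
    (hi : Function.Injective
      (isComplEquivLinearMap h π - isComplEquivLinearMap h π' : Q →ₗ[F] U)) :
    Disjoint π.1 π'.1 := by
  rw [Submodule.disjoint_def]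
  intro w hw hw'
  obtain ⟨u, x, rfl, -⟩ := Submodule.existsUnique_add_of_isCompl h w
  have h1 : U.projectionOnto π.1 π.2 (u + x) = 0 :=
    (Submodule.projectionOnto_apply_eq_zero_iff π.2).2 hw
  have h2 : U.projectionOnto π'.1 π'.2 (u + x) = 0 :=
    (Submodule.projectionOnto_apply_eq_zero_iff π'.2).2 hw'
  rw [map_add, Submodule.projectionOnto_apply_left] at h1 h2
  have hx : x = 0 := by
    apply hi
    rw [map_zero, LinearMap.sub_apply, isComplEquivLinearMap_apply, isComplEquivLinearMap_apply,
      sub_eq_zero]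
    exact add_left_cancel (h1.trans h2.symm)
  subst hx
  simpa using h1

/-- The number of complements of an `m`-dimensional subspace of an `(n + m)`-dimensional space. -/
theorem natCard_isCompl [Finite F] [FiniteDimensional F W] {n m : ℕ} (U : Submodule F W)
    (hU : finrank F U = m) (hW : finrank F W = n + m) :
    Nat.card {π : Submodule F W // IsCompl U π} = Nat.card F ^ (n * m) := by
  obtain ⟨Q, hQ⟩ := U.exists_isCompl
  have := Submodule.finrank_add_eq_of_isCompl hQ
  have hQn : finrank F Q = n := by omega
  rw [Nat.card_congr (isComplEquivLinearMap hQ), Module.natCard_eq_pow_finrank (K := F),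
    finrank_linearMap, hU, hQn]

/-- The Erdős–Ko–Rado bound for bilinear forms: pairwise non-disjoint complements. -/
theorem ncard_le_of_pairwise_not_disjoint [Finite F] [FiniteDimensional F W] {n m : ℕ}
    (hn : 0 < n) (hnm : n ≤ m) (U : Submodule F W) (hU : finrank F U = m)
    (hW : finrank F W = n + m) (A : Set {π : Submodule F W // IsCompl U π})
    (hA : ∀ π ∈ A, ∀ π' ∈ A, ¬ Disjoint π.1 π'.1) :
    A.ncard ≤ Nat.card F ^ ((n - 1) * m) := by
  obtain ⟨Q, hQ⟩ := U.exists_isCompl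
  have := Submodule.finrank_add_eq_of_isCompl hQ
  have hQn : finrank F Q = n := by omega
  obtain ⟨C, hC, hinj⟩ := exists_submodule_linearMap_injective (F := F) Q U
    (by omega) (by omega)
  have : Finite ((Q →ₗ[F] U) ⧸ C) := Module.finite_of_finite F
  have hcard : Nat.card ((Q →ₗ[F] U) ⧸ C) = Nat.card F ^ ((n - 1) * m) := by
    rw [Module.natCard_eq_pow_finrank (K := F)]
    have := C.finrank_quotient_add_finrank
    rw [finrank_linearMap, hC, hU, hQn] at this
    congr 1
    rw [Nat.sub_mul]
    omega
  -- Distinct members in one coset of `C` would differ by an injective map and so be disjoint: each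
  -- coset holds at most one.
  have hmap : Set.InjOn (fun π ↦ C.mkQ (isComplEquivLinearMap hQ π)) A := by
    intro π hπ π' hπ' heq
    by_contra hne
    refine hA π hπ π' hπ' (disjoint_of_injective_sub hQ π π' (hinj _ ?_ ?_))
    · exact (Submodule.Quotient.eq C).mp heq
    · exact sub_ne_zero.mpr fun h ↦ hne ((isComplEquivLinearMap hQ).injective h)
  rw [← hcard, ← Set.ncard_univ]
  exact Set.ncard_le_ncard_of_injOn _ (fun _ _ ↦ Set.mem_univ _) hmap

end Complements

/-! ### Vertices contained in a subspace of type `(n + l - 1, l - 1)`. -/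

namespace BilinearForms

open Module

variable {F : Type*} [Field F] {n l : ℕ}

theorem mem_attenuated_iff {m : ℕ} {P : Submodule F (Fin (n + l) → F)} :
    P ∈ attenuated F n l m ↔ finrank F P = m ∧ Disjoint P (E F n l) := by
  simp [attenuated, subspacesOfType, disjoint_iff]

theorem finrank_comap_subtype {W : Type*} [AddCommGroup W] [Module F W] (V P : Submodule F W) :
    finrank F (P.comap V.subtype) = finrank F ↥(V ⊓ P) := by
  rw [← Submodule.map_comap_subtype, Submodule.finrank_map_subtype_eq]

theorem attenuatedIn_eq_image (hn : 0 < n) (hl : 0 < l) {V : Submodule F (Fin (n + l) → F)}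
    (hV : V ∈ subspacesOfType F n l (n + l - 1) (l - 1)) :
    attenuatedIn n V = (fun π : {π // IsCompl ((E F n l).comap V.subtype) π} ↦
      π.1.map V.subtype) '' Set.univ := by
  have hU : finrank F ((E F n l).comap V.subtype) = l - 1 :=
    (finrank_comap_subtype V _).trans hV.2
  have hV1 : finrank F V = n + l - 1 := hV.1
  ext P
  constructor
  · rintro ⟨hP, hPV⟩
    rw [mem_attenuated_iff] at hP
    refine ⟨⟨P.comap V.subtype, ?_⟩, Set.mem_univ _, ?_⟩
    · rw [Submodule.isCompl_iff_disjoint]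
      · rw [disjoint_iff, ← Submodule.comap_inf, hP.2.symm.eq_bot, Submodule.comap_bot,
          Submodule.ker_subtype]
      · rw [hU, hV1, finrank_comap_subtype, inf_eq_right.mpr hPV, hP.1]
        omega
    · simp [hPV]
  · rintro ⟨⟨π, hπ⟩, -, rfl⟩
    have h := Submodule.finrank_add_eq_of_isCompl hπ
    have : finrank F (π.map V.subtype) = finrank F π := Submodule.finrank_map_subtype_eq V π
    refine ⟨mem_attenuated_iff.mpr ⟨?_, ?_⟩, Submodule.map_subtype_le _ _⟩
    · rw [this]
      omega
    · rw [Submodule.disjoint_def]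
      rintro _ ⟨x, hx, rfl⟩ hxE
      rw [(Submodule.disjoint_def.mp hπ.disjoint) x hxE hx, map_zero]

theorem map_subtype_injective {W : Type*} [AddCommGroup W] [Module F W] {V : Submodule F W}
    (p : Submodule F V → Prop) :
    Function.Injective fun π : {π : Submodule F V // p π} ↦ π.1.map V.subtype :=
  (Submodule.map_injective_of_injective V.injective_subtype).comp Subtype.val_injective

/-- The number of vertices of `Bil_q(n, l)` contained in a subspace of type
`(n + l - 1, l - 1)`. -/
theorem ncard_attenuatedIn [Finite F] (hn : 0 < n) (hl : 0 < l)
    {V : Submodule F (Fin (n + l) → F)} (hV : V ∈ subspacesOfType F n l (n + l - 1) (l - 1)) :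
    (attenuatedIn n V).ncard = Nat.card F ^ (n * (l - 1)) := by
  rw [attenuatedIn_eq_image hn hl hV, Set.ncard_image_of_injective _ (map_subtype_injective _),
    Set.ncard_univ, natCard_isCompl _ ((finrank_comap_subtype V _).trans hV.2)]
  rw [show finrank F V = n + l - 1 from hV.1]
  omega

theorem IsIntersecting.ncard_inter_attenuatedIn_le [Finite F] (hn : 0 < n) (hnl : n < l)
    {V : Submodule F (Fin (n + l) → F)} (hV : V ∈ subspacesOfType F n l (n + l - 1) (l - 1))
    {A : Set (Submodule F (Fin (n + l) → F))} (hA : IsIntersecting A) :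
    (A ∩ attenuatedIn n V).ncard ≤ Nat.card F ^ ((n - 1) * (l - 1)) := by
  have h : A ∩ attenuatedIn n V = (fun π : {π // IsCompl ((E F n l).comap V.subtype) π} ↦
      π.1.map V.subtype) '' {π | π.1.map V.subtype ∈ A} := by
    rw [attenuatedIn_eq_image hn (by omega) hV]
    aesop
  rw [h, Set.ncard_image_of_injective _ (map_subtype_injective _)]
  -- The bound needs `n ≤ l - 1`, which is `n < l`.
  refine ncard_le_of_pairwise_not_disjoint hn (by omega) _
    ((finrank_comap_subtype V _).trans hV.2) ?_ _ ?_
  · rw [show finrank F V = n + l - 1 from hV.1]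
    omega
  · intro π hπ π' hπ' hd
    have h1 := hA.2 _ hπ _ hπ'
    rw [← Submodule.map_inf _ V.injective_subtype, hd.eq_bot, Submodule.map_bot,
      finrank_bot] at h1
    omega

/-! ### The Cameron-Liebler property of a hyperplane. -/

/-- A subspace meeting `E` trivially contains `1 + q + ⋯ + q ^ (d - 1)` points of the attenuated
space, where `d` is its dimension. -/
theorem natCard_points_le [Finite F] {S : Submodule F (Fin (n + l) → F)}
    (hS : Disjoint S (E F n l)) :
    Nat.card {τ : attenuated F n l 1 // τ.1 ≤ S} =
      ∑ i ∈ Finset.range (finrank F S), Nat.card F ^ i := by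
  rw [← Projectivization.card_of_finrank F S rfl,
    Nat.card_congr (Projectivization.equivSubmodule F S)]
  refine Nat.card_congr
    { toFun τ := ⟨τ.1.1.comap S.subtype, ?_⟩
      invFun H := ⟨⟨H.1.map S.subtype, ?_⟩, Submodule.map_subtype_le _ _⟩
      left_inv τ := ?_
      right_inv H := ?_ }
  · rw [finrank_comap_subtype, inf_eq_right.mpr τ.2]
    exact τ.1.2.1
  · rw [mem_attenuated_iff, Submodule.finrank_map_subtype_eq]
    exact ⟨H.2, hS.mono_left (Submodule.map_subtype_le _ _)⟩
  · ext1; ext1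
    simp [τ.2]
  · ext1
    exact Submodule.comap_map_eq_of_injective S.injective_subtype _

theorem charVec_mem_range [Fintype F] (hn : 0 < n) {V : Submodule F (Fin (n + l) → F)}
    (hV : finrank F V = n + l - 1) :
    charVec (attenuatedIn n V) ∈ LinearMap.range (incidenceMatrix F n l)ᵀ.mulVecLin := by
  classical
  set q : ℝ := (Nat.card F : ℝ)
  set N : ℕ → ℝ := fun d ↦ ∑ i ∈ Finset.range d, q ^ i
  have hq : 0 < q := Nat.cast_pos.mpr Nat.card_pos
  have hN : N n = N (n - 1) + q ^ (n - 1) := by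
    conv_lhs => rw [← Nat.sub_add_cancel hn]
    exact Finset.sum_range_succ _ _
  have hNpos : 0 < N n := Finset.sum_pos (fun i _ ↦ by positivity) (by simpa using hn.ne')
  have hcount : ∀ S : Submodule F (Fin (n + l) → F), Disjoint S (E F n l) →
      ∑ τ : attenuated F n l 1, (if τ.1 ≤ S then (1 : ℝ) else 0) = N (finrank F S) := by
    intro S hS
    rw [Finset.sum_boole, ← Fintype.card_subtype, ← Nat.card_eq_fintype_card,
      natCard_points_le hS]
    simp [N, q]
  -- Weights `a` on `V` and `b` off it solve `a * N n = 1` and `a * N (n - 1) + b * q ^ (n - 1) =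
  -- 0`.
  set b : ℝ := -(N (n - 1)) / (N n * q ^ (n - 1))
  set a : ℝ := 1 / N n
  refine ⟨fun τ ↦ b + (a - b) * if τ.1 ≤ V then 1 else 0, ?_⟩
  ext ⟨π, hπ⟩
  have hπ' := mem_attenuated_iff.mp hπ
  have hsum : (incidenceMatrix F n l)ᵀ.mulVecLin
      (fun τ ↦ b + (a - b) * if τ.1 ≤ V then 1 else 0) ⟨π, hπ⟩ =
      b * N (finrank F π) + (a - b) * N (finrank F ↥(π ⊓ V)) := by
    rw [← hcount _ hπ'.2, ← hcount _ (hπ'.2.mono_left inf_le_left), Finset.mul_sum,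
      Finset.mul_sum, ← Finset.sum_add_distrib]
    simp only [Matrix.mulVecLin_apply, Matrix.mulVec, dotProduct, Matrix.transpose_apply,
      incidenceMatrix, Matrix.of_apply, le_inf_iff]
    refine Finset.sum_congr rfl fun τ _ ↦ ?_
    by_cases h1 : τ.1 ≤ π <;> by_cases h2 : τ.1 ≤ V <;> simp [h1, h2]
  rw [hsum, hπ'.1]
  by_cases hle : π ≤ V
  · have : π ∈ attenuatedIn n V := ⟨hπ, hle⟩
    have hdim : finrank F ↥(π ⊓ V) = n := by rw [inf_eq_left.mpr hle, hπ'.1]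
    simp only [charVec, this, if_true, hdim, a]
    field_simp
    ring
  · have : π ∉ attenuatedIn n V := fun h ↦ hle h.2
    have hdim : finrank F ↥(π ⊓ V) = n - 1 := by
      have h1 := Submodule.finrank_sup_add_finrank_inf_eq π V
      have h2 : finrank F V < finrank F ↥(π ⊔ V) :=
        Submodule.finrank_lt_finrank_of_lt (right_lt_sup.mpr hle)
      have h3 := Submodule.finrank_le (π ⊔ V)
      rw [finrank_fin_fun] at h3
      have := hπ'.1
      omega
    simp only [charVec, this, if_false, hdim, a, b]
    rw [hN] at hNpos ⊢
    field_simp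
    ring

/-! ### Disjoint unions and non-triviality. -/

theorem charVec_iUnion {ι : Type*} [Fintype ι] (L : ι → Set (Submodule F (Fin (n + l) → F)))
    (hL : ∀ i j, i ≠ j → L i ∩ L j = ∅) :
    charVec (⋃ i, L i) = ∑ i, charVec (n := n) (l := l) (L i) := by
  classical
  ext π
  rw [Finset.sum_apply]
  by_cases h : ∃ i, π.1 ∈ L i
  · obtain ⟨i, hi⟩ := h
    rw [Finset.sum_eq_single i]
    · have : π.1 ∈ ⋃ i, L i := Set.mem_iUnion.mpr ⟨i, hi⟩
      simp only [charVec, this, hi]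
    · intro j _ hj
      have : π.1 ∉ L j := fun hj' ↦ (Set.disjoint_iff_inter_eq_empty.mpr (hL j i hj)).le_bot ⟨hj', hi⟩
      simp only [charVec, this, if_false]
    · simp
  · have h' : π.1 ∉ ⋃ i, L i := by simpa using h
    push Not at h
    simp only [charVec, h', h, if_false, Finset.sum_const_zero]

theorem ncard_iUnion_attenuatedIn [Finite F] (hn : 0 < n) (hl : 0 < l) {y : ℕ}
    (V : Fin y → Submodule F (Fin (n + l) → F))
    (hV : ∀ i, V i ∈ subspacesOfType F n l (n + l - 1) (l - 1))
    (hd : ∀ i j, i ≠ j → attenuatedIn n (V i) ∩ attenuatedIn n (V j) = ∅) :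
    (⋃ i, attenuatedIn n (V i)).ncard = y * Nat.card F ^ (n * (l - 1)) := by
  rw [Set.ncard_iUnion_of_finite (fun i ↦ Set.toFinite _)
    fun i j hij ↦ Set.disjoint_iff_inter_eq_empty.mpr (hd i j hij), finsum_eq_sum_of_fintype]
  simp [ncard_attenuatedIn hn hl (hV _)]

theorem isNontrivialCameronLiebler_iUnion [Fintype F] (hn : 2 ≤ n) (hnl : n < l) {y : ℕ}
    (hy : 1 ≤ y) (hyq : y < Fintype.card F ^ (n - 1))
    (V : Fin y → Submodule F (Fin (n + l) → F))
    (hV : ∀ i, V i ∈ subspacesOfType F n l (n + l - 1) (l - 1))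
    (hd : ∀ i j, i ≠ j → attenuatedIn n (V i) ∩ attenuatedIn n (V j) = ∅) :
    IsNontrivialCameronLiebler (⋃ i, attenuatedIn n (V i))
      ((y : ℝ) * (Fintype.card F : ℝ) ^ (l - n)) := by
  have hcard := ncard_iUnion_attenuatedIn (by omega) (by omega) V hV hd
  rw [Nat.card_eq_fintype_card] at hcard
  have hq : 0 < Fintype.card F := Fintype.card_pos
  refine ⟨⟨Set.iUnion_subset fun i P hP ↦ hP.1, ?_, ?_⟩, ?_⟩
  · rw [charVec_iUnion _ hd]
    exact Submodule.sum_mem _ fun i _ ↦ charVec_mem_range (by omega) (hV i).1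
  · have hq' : (Fintype.card F : ℝ) ≠ 0 := by positivity
    rw [hcard, Nat.cast_mul, Nat.cast_pow, mul_left_comm, ← zpow_natCast, ← zpow_natCast,
      ← zpow_add₀ hq']
    congr 2
    rw [Nat.cast_sub hnl.le, Nat.cast_mul, Nat.cast_sub (by omega)]
    push_cast
    ring
  · rintro ⟨k, hk, A, hA, hL⟩
    have hk' : k = y * Fintype.card F ^ (l - n) := by exact_mod_cast hk
    have hAi : ∀ i, (A i).ncard ≤ y * Fintype.card F ^ ((n - 1) * (l - 1)) := by
      intro i
      have hsub : A i = ⋃ j, A i ∩ attenuatedIn n (V j) := by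
        rw [← Set.inter_iUnion, hL]
        exact (Set.inter_eq_left.mpr (Set.subset_iUnion A i)).symm
      rw [hsub]
      refine (Set.ncard_iUnion_le_of_fintype _).trans ?_
      refine (Finset.sum_le_card_nsmul _ _ _ fun j _ ↦
        (hA i).ncard_inter_attenuatedIn_le (by omega) hnl (hV j)).trans ?_
      simp
    have hle : y * Fintype.card F ^ (n * (l - 1)) ≤
        k * (y * Fintype.card F ^ ((n - 1) * (l - 1))) := by
      rw [← hcard, hL]
      refine (Set.ncard_iUnion_le_of_fintype _).trans ?_
      refine (Finset.sum_le_card_nsmul _ _ _ fun i _ ↦ hAi i).trans ?_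
      simp
    -- The surplus exponent `n - 1` is what remains after cancelling in `hle`, forcing `q^(n-1) ≤
    -- y`.
    have hexp : n * (l - 1) = (l - n) + (n - 1) * (l - 1) + (n - 1) := by
      obtain ⟨a, rfl⟩ : ∃ a, n = a + 1 := ⟨n - 1, by omega⟩
      obtain ⟨b, rfl⟩ : ∃ b, l = b + (a + 1) := ⟨l - (a + 1), by omega⟩
      simp only [Nat.add_sub_cancel, show b + (a + 1) - 1 = b + a by omega]
      ring
    rw [hexp, hk', pow_add, pow_add] at hle
    have hpos : 0 < y * (Fintype.card F ^ (l - n) * Fintype.card F ^ ((n - 1) * (l - 1))) := by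
      positivity
    have := Nat.mul_lt_mul_of_pos_left hyq hpos
    nlinarith

end BilinearForms

end

theorem mainTheorem5 {F : Type*} [Field F] [Fintype F] (n l : ℕ) (hn : 2 ≤ n) (hnl : n < l) :
    (∀ V ∈ BilinearForms.subspacesOfType F n l (n + l - 1) (l - 1),
      BilinearForms.IsNontrivialCameronLiebler (BilinearForms.attenuatedIn n V)
        ((Fintype.card F : ℝ) ^ (l - n))) ∧
    (∀ y : ℕ, 1 ≤ y → y < Fintype.card F ^ (n - 1) →
      ∀ V : Fin y → Submodule F (Fin (n + l) → F),
        (∀ i, V i ∈ BilinearForms.subspacesOfType F n l (n + l - 1) (l - 1)) →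
        (∀ i j, i ≠ j →
          BilinearForms.attenuatedIn n (V i) ∩ BilinearForms.attenuatedIn n (V j) = ∅) →
        BilinearForms.IsNontrivialCameronLiebler (⋃ i, BilinearForms.attenuatedIn n (V i))
          ((y : ℝ) * (Fintype.card F : ℝ) ^ (l - n))) := by
  refine ⟨fun V hV ↦ ?_, fun y hy hyq V hV hd ↦
    BilinearForms.isNontrivialCameronLiebler_iUnion hn hnl hy hyq V hV hd⟩
  -- Part (i) is the case `y = 1`; `1 < q^(n-1)` because `n ≥ 2`.
  have h := BilinearForms.isNontrivialCameronLiebler_iUnion hn hnl le_rfl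
    (Nat.one_lt_pow (by omega) Fintype.one_lt_card) (fun _ : Fin 1 ↦ V) (fun _ ↦ hV)
    (fun i j hij ↦ absurd (Subsingleton.elim i j) hij)
  simpa [Set.iUnion_const] using h
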